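/- Let $G$ be a finite or infinite connected simple graph of maximum valence $3$. Suppose that $G$ has a vertex $v$ of valence $3$ such that every automorphism of $G$ that fixes $v$ fixes each of the three edges incident to $v$ (a vertex of type 1). Then $G$ has a vertex coloring with two colors that is preserved by no automorphism of $G$ other than the identity. More precisely, let the distinguishing number $D(G)$ be the least number of colors in a (not necessarily proper) vertex coloring of $G$ such that the identity is the only color-preserving automorphism of $G$. Then $D(G)=2$ if $G$ has a non-identity automorphism, and $D(G)=1$ otherwise. -/

import Mathlib

namespace SimpleGraph

variable {V : Type*}

/-- The valence (degree) of a vertex, with value `⊤` if the vertex has infinitely many neighbours. -/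
noncomputable def valence (G : SimpleGraph V) (v : V) : ℕ∞ :=
  (G.neighborSet v).encard

/-- The maximum valence `Δ(G)`: the supremum of the valences of the vertices. -/
noncomputable def maxValence (G : SimpleGraph V) : ℕ∞ :=
  ⨆ v, G.valence v

/-- A colouring of the vertices (not necessarily proper) is distinguishing if the only
automorphism of the graph that preserves it is the identity. -/
def IsDistinguishing (G : SimpleGraph V) {α : Type*} (c : V → α) : Prop :=
  ∀ φ : G ≃g G, (∀ v, c (φ v) = c v) → ∀ v, φ v = v

/-- The distinguishing number `D(G)`: the least number of colours of a distinguishing colouring,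
with value `⊤` if no finite number of colours is enough. -/
noncomputable def distinguishingNumber (G : SimpleGraph V) : ℕ∞ :=
  ⨅ n ∈ {n : ℕ | ∃ c : V → Fin n, G.IsDistinguishing c}, (n : ℕ∞)

/-- A vertex is of type 1 if its stabilizer in the automorphism group acts trivially on the
set of edges incident to it. -/
def IsTypeOne (G : SimpleGraph V) (v : V) : Prop :=
  ∀ φ : G ≃g G, φ v = v → ∀ e ∈ G.incidenceSet v, Sym2.map φ e = e

end SimpleGraph

/-! Colour the root `v` black, its neighbours black except the adjacent twins of `v`, and one vertex
of each pair of distinct mates at distance at least 2 black; all else is white.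

If a colour-preserving automorphism fixes `v`, type 1 makes it fix the neighbours of `v`. By
induction on the distance it then sends each vertex to a mate. A vertex at distance at least 2 has
at most one other mate, and that mate has the other colour, so the automorphism is the identity
(`eq_of_preserves_blackSet`).

It remains to recognise `v` by its colour: it is the only black vertex of valence 3 all of whose
neighbours are black or adjacent twins of it. Suppose `x ≠ v` is another. A black child of `x` (a
neighbour farther from `v`) brings its white mate along as a second child, so `x` has no children.
At distance 1 this makes `x` a twin of `v`, hence white. Farther out, `x` has either a neighbour on
its level that is not a mate or two parents; both are excluded by a selection under which no black
vertex has all its related vertices black, except for two parents at distance 1, which are excluded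
by type 1. Such a selection exists by minimality on each finite level
(`exists_selection_of_finite`). -/

/-- A finite set with an involution and a symmetric relation compatible with it: one can select one
point from each two-element orbit so that no selected point that has related points has all of them
selected. -/
theorem exists_selection_of_finite {α : Type*} (S : Finset α) (σ : α → α) (R : α → α → Prop)
    (hS : ∀ a ∈ S, σ a ∈ S) (hσ : ∀ a ∈ S, σ (σ a) = a)
    (hsymm : ∀ a b, R a b → R b a) (hirr : ∀ a, ¬ R a a)
    (hR : ∀ a ∈ S, ∀ c ∈ S, σ a ≠ a → σ c ≠ c → R (σ a) c → R a (σ c)) :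
    ∃ T : Finset α, (∀ a ∈ S, a ∈ T → σ a ≠ a) ∧ (∀ a ∈ S, σ a ≠ a → (a ∈ T ↔ σ a ∉ T)) ∧
      ∀ a ∈ S, a ∈ T → (∃ b, R a b) → ∃ b, R a b ∧ b ∉ T := by
  classical
  let good : Finset α → Prop := fun T =>
    (∀ a ∈ S, a ∈ T → σ a ≠ a) ∧ (∀ a ∈ S, σ a ≠ a → (a ∈ T ↔ σ a ∉ T))
  let cost : Finset α → Finset (α × α) := fun T => (T ×ˢ T).filter fun q => R q.1 q.2
  have hne : (S.powerset.filter good).Nonempty := by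
    -- Any choice of one point per orbit will do; a well-order supplies one.
    refine ⟨S.filter fun a => WellOrderingRel a (σ a), ?_⟩
    simp only [Finset.mem_filter, Finset.mem_powerset, Finset.filter_subset, true_and, good]
    refine ⟨fun a _ h e => ?_, fun a ha hne => ?_⟩
    · rw [e] at h
      exact irrefl_of WellOrderingRel a h.2
    · simp only [ha, hS a ha, hσ a ha, true_and]
      constructor
      · exact fun h => asymm_of WellOrderingRel h
      · intro h
        rcases trichotomous_of WellOrderingRel a (σ a) with h' | h' | h'
        · exact h'
        · exact absurd h'.symm hne
        · exact absurd h' h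
  obtain ⟨T, hT, hmin⟩ := Finset.exists_min_image _ (fun T => (cost T).card) hne
  simp only [Finset.mem_filter, Finset.mem_powerset] at hT hmin
  obtain ⟨hTS, hT1, hT2⟩ := hT
  refine ⟨T, hT1, hT2, fun a haS haT hab => ?_⟩
  by_contra! hall
  obtain ⟨b, hb⟩ := hab
  have hane := hT1 a haS haT
  -- Compatibility turns a selected `c` related to `σ a` into `σ c` related to `a`, which would then
  -- be selected together with `c`. So exchanging `a` for `σ a` creates no related pair inside `T`
  -- and destroys `(a, b)`, against minimality.
  have hno : ∀ c ∈ T, ¬ R (σ a) c := fun c hc h =>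
    (hT2 c (hTS hc) (hT1 c (hTS hc) hc)).1 hc
      (hall _ (hR a haS c (hTS hc) hane (hT1 c (hTS hc) hc) h))
  let T' := insert (σ a) (T.erase a)
  have hmemT' : ∀ c, c ∈ T' ↔ c = σ a ∨ c ≠ a ∧ c ∈ T := fun c => by
    simp [T']
  have hgood : T' ⊆ S ∧ good T' := by
    refine ⟨fun c hc => ?_, fun c hc hcT => ?_, fun c hc hcne => ?_⟩
    · rcases (hmemT' c).1 hc with rfl | h
      · exact hS a haS
      · exact hTS h.2
    · rcases (hmemT' c).1 hcT with rfl | h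
      · rw [hσ a haS]; exact hane.symm
      · exact hT1 c hc h.2
    · rw [hmemT', hmemT']
      by_cases h1 : c = a
      · subst h1; simp [hane.symm]
      by_cases h2 : c = σ a
      · subst h2; simp [hσ a haS, hane.symm]
      have h3 : σ c ≠ σ a := fun h => h1 (by rw [← hσ c hc, h, hσ a haS])
      have h4 : σ c ≠ a := fun h => h2 (by rw [← hσ c hc, h])
      simp only [h1, h2, h3, h4, false_or, ne_eq, not_false_eq_true, true_and]
      exact hT2 c hc hcne
  have hle := hmin T' hgood
  refine absurd hle (not_le.2 (Finset.card_lt_card ?_))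
  rw [Finset.ssubset_iff_of_subset]
  · refine ⟨(a, b), ?_, ?_⟩
    · simp only [cost, Finset.mem_filter, Finset.mem_product]
      exact ⟨⟨haT, hall b hb⟩, hb⟩
    · simp only [cost, Finset.mem_filter, Finset.mem_product, not_and]
      intro h
      rcases (hmemT' a).1 h.1 with h | h
      · exact absurd h.symm hane
      · exact absurd rfl h.1
  · rintro ⟨c, d⟩ h
    simp only [cost, Finset.mem_filter, Finset.mem_product, hmemT'] at h ⊢
    obtain ⟨⟨hc, hd⟩, hcd⟩ := h
    rcases hc with rfl | hc
    · rcases hd with rfl | hd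
      · exact absurd hcd (hirr _)
      · exact absurd hcd (hno d hd.2)
    · rcases hd with rfl | hd
      · exact absurd (hsymm _ _ hcd) (hno c hc.2)
      · exact ⟨⟨hc.2, hd.2⟩, hcd⟩

namespace SimpleGraph

variable {V : Type*} {G : SimpleGraph V} {v : V}

/-! ### Valence and distance from the root -/

theorem eq_of_valence_le_three {p a b c d : V} (hp : G.valence p ≤ 3)
    (ha : G.Adj p a) (hb : G.Adj p b) (hc : G.Adj p c) (hd : G.Adj p d)
    (hab : a ≠ b) (hac : a ≠ c) (hbc : b ≠ c) : d = a ∨ d = b ∨ d = c := by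
  by_contra! h
  have hsub : ({d, a, b, c} : Set V) ⊆ G.neighborSet p := by
    rintro z (rfl | rfl | rfl | rfl) <;> assumption
  have h4 : ({d, a, b, c} : Set V).encard = 4 := by
    rw [Set.encard_insert_of_notMem (by simpa using h),
      Set.encard_eq_three.2 ⟨a, b, c, hab, hac, hbc, rfl⟩]
    norm_num
  have := (Set.encard_mono hsub).trans hp
  rw [h4] at this
  exact absurd this (by norm_num)

theorem Connected.dist_le_succ_of_adj (hconn : G.Connected) {a b : V} (h : G.Adj a b) :
    G.dist v b ≤ G.dist v a + 1 := by
  have := hconn.dist_triangle (u := v) (v := a) (w := b)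
  rwa [dist_eq_one_iff_adj.2 h] at this

theorem Connected.exists_adj_dist_succ_eq (hconn : G.Connected) {a : V} (ha : G.dist v a ≠ 0) :
    ∃ p, G.Adj p a ∧ G.dist v p + 1 = G.dist v a := by
  obtain ⟨w, hw⟩ := hconn.exists_walk_length_eq_dist a v
  rw [dist_comm] at hw
  cases w with
  | nil => simp at ha
  | @cons _ p _ h w =>
    refine ⟨p, h.symm, ?_⟩
    have h1 : G.dist v p ≤ w.length := by rw [dist_comm]; exact dist_le w
    have h2 := hconn.dist_le_succ_of_adj (v := v) h.symm
    simp only [Walk.length_cons] at hw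
    omega

theorem Connected.dist_map_le (hconn : G.Connected) (φ : G ≃g G) (a b : V) :
    G.dist (φ a) (φ b) ≤ G.dist a b := by
  obtain ⟨w, hw⟩ := hconn.exists_walk_length_eq_dist a b
  rw [← hw, ← Walk.length_map φ.toHom w]
  exact dist_le _

theorem Connected.dist_map (hconn : G.Connected) (φ : G ≃g G) (a b : V) :
    G.dist (φ a) (φ b) = G.dist a b := by
  refine (hconn.dist_map_le φ a b).antisymm ?_
  simpa using hconn.dist_map_le φ.symm (φ a) (φ b)

theorem finite_setOf_dist_eq (hconn : G.Connected) (hle : ∀ u, G.valence u ≤ 3) (n : ℕ) :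
    {u | G.dist v u = n}.Finite := by
  induction n with
  | zero =>
    refine (Set.finite_singleton v).subset fun u hu => ?_
    exact (hconn.dist_eq_zero_iff.1 hu).symm
  | succ n ih =>
    refine (ih.biUnion fun u _ => ?_ : (⋃ u ∈ {u | G.dist v u = n}, G.neighborSet u).Finite).subset
      fun u hu => ?_
    · refine Set.finite_of_encard_le_coe (k := 3) ?_
      exact hle u
    · simp only [Set.mem_ofPred_eq] at hu
      obtain ⟨p, hp, hd⟩ := hconn.exists_adj_dist_succ_eq (v := v) (a := u) (by omega)
      exact Set.mem_biUnion (show G.dist v p = n by omega) hp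

/-! ### Mates -/

/-- `b` is a mate of `a` with respect to the root `v` if some automorphism maps `a` to `b` and fixes
all vertices that are closer to `v` than `a` is. -/
def Mate (G : SimpleGraph V) (v a b : V) : Prop :=
  ∃ h : G ≃g G, (∀ u, G.dist v u < G.dist v a → h u = u) ∧ h a = b

theorem dist_map_of_fix (hconn : G.Connected) {n : ℕ} (hn : 0 < n) {h : G ≃g G}
    (hh : ∀ u, G.dist v u < n → h u = u) (u : V) : G.dist v (h u) = G.dist v u := by
  have hv : h v = v := hh v (by simpa using hn)
  conv_lhs => rw [← hv]
  exact hconn.dist_map h v u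

theorem Mate.refl (a : V) : G.Mate v a a := ⟨Iso.refl, fun _ _ => rfl, rfl⟩

theorem Mate.dist_eq (hconn : G.Connected) {a b : V} (ha : 0 < G.dist v a) (h : G.Mate v a b) :
    G.dist v b = G.dist v a := by
  obtain ⟨h, hh, rfl⟩ := h
  exact dist_map_of_fix hconn ha hh a

theorem Mate.symm (hconn : G.Connected) {a b : V} (ha : 0 < G.dist v a) (h : G.Mate v a b) :
    G.Mate v b a := by
  have hd := h.dist_eq hconn ha
  obtain ⟨h, hh, rfl⟩ := h
  refine ⟨h.symm, fun u hu => ?_, h.symm_apply_apply a⟩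
  rw [hd] at hu
  conv_lhs => rw [← hh u hu]
  exact h.symm_apply_apply u

theorem Mate.trans (hconn : G.Connected) {a b c : V} (ha : 0 < G.dist v a) (h : G.Mate v a b)
    (h' : G.Mate v b c) : G.Mate v a c := by
  have hd := h.dist_eq hconn ha
  obtain ⟨h, hh, rfl⟩ := h
  obtain ⟨g, hg, rfl⟩ := h'
  refine ⟨h.trans g, fun u hu => ?_, rfl⟩
  rw [RelIso.trans_apply, hh u hu, hg u (by omega)]

theorem Mate.adj {p a b : V} (hpa : G.Adj p a) (hd : G.dist v p < G.dist v a)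
    (h : G.Mate v a b) : G.Adj p b := by
  obtain ⟨h, hh, rfl⟩ := h
  have := h.map_rel_iff.2 hpa
  rwa [hh p hd] at this

/-- All mates of `a` are adjacent to a parent `p` of `a`. Since `p` is not the root, one of its at
most three edges leads back towards `v`, leaving room for two mates. -/
theorem Mate.eq_of_ne (hconn : G.Connected) (hle : ∀ u, G.valence u ≤ 3) {a b c : V}
    (ha : 2 ≤ G.dist v a) (hb : G.Mate v a b) (hc : G.Mate v a c) (hba : b ≠ a) (hca : c ≠ a) :
    c = b := by
  obtain ⟨p, hpa, hp⟩ := hconn.exists_adj_dist_succ_eq (v := v) (a := a) (by omega)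
  obtain ⟨q, hqp, hq⟩ := hconn.exists_adj_dist_succ_eq (v := v) (a := p) (by omega)
  have hbd := hb.dist_eq hconn (by omega)
  have hcd := hc.dist_eq hconn (by omega)
  have hqa : q ≠ a := by rintro rfl; omega
  have hqb : q ≠ b := by rintro rfl; omega
  rcases eq_of_valence_le_three (hle p) hqp.symm hpa (hb.adj hpa (by omega))
    (hc.adj hpa (by omega)) hqa hqb hba.symm with h | h | h
  · subst h; omega
  · exact absurd h hca
  · exact h

open Classical in
/-- The mate of `a` other than `a` itself if there is one, and `a` otherwise. -/
noncomputable def partner (G : SimpleGraph V) (v a : V) : V :=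
  if h : ∃ b, G.Mate v a b ∧ b ≠ a then h.choose else a

theorem mate_partner (a : V) : G.Mate v a (G.partner v a) := by
  unfold partner
  split_ifs with h
  · exact h.choose_spec.1
  · exact Mate.refl a

theorem Mate.eq_or_eq_partner (hconn : G.Connected) (hle : ∀ u, G.valence u ≤ 3) {a b : V}
    (ha : 2 ≤ G.dist v a) (h : G.Mate v a b) : b = a ∨ b = G.partner v a := by
  by_cases hb : b = a
  · exact Or.inl hb
  · have hex : ∃ b, G.Mate v a b ∧ b ≠ a := ⟨b, h, hb⟩
    right
    unfold partner
    rw [dif_pos hex]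
    exact Mate.eq_of_ne hconn hle ha hex.choose_spec.1 h hex.choose_spec.2 hb

theorem dist_partner (hconn : G.Connected) {a : V} (ha : 0 < G.dist v a) :
    G.dist v (G.partner v a) = G.dist v a :=
  (mate_partner a).dist_eq hconn ha

theorem partner_partner (hconn : G.Connected) (hle : ∀ u, G.valence u ≤ 3) {a : V}
    (ha : 2 ≤ G.dist v a) : G.partner v (G.partner v a) = a := by
  have hd := dist_partner hconn (show 0 < G.dist v a by omega)
  have h1 := (mate_partner (G := G) (v := v) a).symm hconn (by omega)
  rcases h1.eq_or_eq_partner hconn hle (by omega) with h | h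
  · rw [← h]; exact h.symm
  · exact h.symm

/-! ### Related vertices and the selection -/

/-- Two vertices at the same distance from `v` that are not mates are related if they are adjacent
or have a common neighbour farther from `v`. -/
def Related (G : SimpleGraph V) (v a b : V) : Prop :=
  G.dist v b = G.dist v a ∧ ¬ G.Mate v a b ∧
    (G.Adj a b ∨ ∃ c, G.dist v c = G.dist v a + 1 ∧ G.Adj a c ∧ G.Adj b c)

theorem Related.symm (hconn : G.Connected) {a b : V} (ha : 0 < G.dist v a)
    (h : G.Related v a b) : G.Related v b a := by
  obtain ⟨hd, hm, h⟩ := h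
  refine ⟨hd.symm, fun h' => hm (h'.symm hconn (by omega)), ?_⟩
  rcases h with h | ⟨c, hc, h1, h2⟩
  · exact Or.inl h.symm
  · exact Or.inr ⟨c, by omega, h2, h1⟩

theorem Related.map (hconn : G.Connected) {a b : V} (ha : 0 < G.dist v a) (h : G.Related v a b)
    {g : G ≃g G} (hg : ∀ u, G.dist v u < G.dist v a → g u = u) :
    G.Related v (g a) (g b) := by
  have hd := dist_map_of_fix hconn ha hg
  obtain ⟨hab, hm, h⟩ := h
  refine ⟨by rw [hd, hd, hab], fun h' => hm ?_, ?_⟩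
  · have h1 : G.Mate v a (g a) := ⟨g, hg, rfl⟩
    have h2 : G.Mate v b (g b) := ⟨g, by rwa [hab], rfl⟩
    exact (h1.trans hconn ha h').trans hconn ha (h2.symm hconn (by omega))
  · rcases h with h | ⟨c, hc, h1, h2⟩
    · exact Or.inl (g.map_rel_iff.2 h)
    · exact Or.inr ⟨g c, by rw [hd, hd, hc], g.map_rel_iff.2 h1, g.map_rel_iff.2 h2⟩

/-- This is the compatibility needed for the exchange argument. An automorphism fixing all lower
levels preserves the relation and moves each vertex of the level to itself or to its partner. -/
theorem Related.partner_right (hconn : G.Connected) (hle : ∀ u, G.valence u ≤ 3) {a c : V}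
    (ha : 2 ≤ G.dist v a) (h : G.Related v (G.partner v a) c) :
    G.Related v a (G.partner v c) := by
  have hda := dist_partner hconn (show 0 < G.dist v a by omega)
  have hdc : G.dist v c = G.dist v a := h.1.trans hda
  have key : ∀ g : G ≃g G, (∀ u, G.dist v u < G.dist v a → g u = u) →
      ∀ u, G.dist v u = G.dist v a → g u = u ∨ g u = G.partner v u := fun g hg u hu =>
    Mate.eq_or_eq_partner hconn hle (by omega) ⟨g, by rwa [hu], rfl⟩
  obtain ⟨g, hg, hgc⟩ := mate_partner (G := G) (v := v) c
  rw [hdc] at hg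
  have hrel := h.map hconn (by omega) (g := g) (by rwa [hda])
  rw [hgc] at hrel
  -- If `g` moves `partner a` to `a`, or `f` moves `c` to `partner c`, that one automorphism
  -- suffices. Otherwise apply `g` and then `f`: as `f` fixes `c`, injectivity makes it fix `partner
  -- c` too.
  rcases key g hg _ hda with h1 | h1
  · obtain ⟨f, hf, hfa⟩ := (mate_partner (G := G) (v := v) a).symm hconn (by omega)
    have hrel' := h.map hconn (by omega) hf
    rw [hfa] at hrel'
    rw [hda] at hf
    rcases key f hf c hdc with h2 | h2
    · rw [h2] at hrel'
      rw [h1] at hrel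
      have hrel2 := hrel.map hconn (by omega) (g := f) (by rwa [hda])
      rw [hfa] at hrel2
      rcases key f hf (G.partner v c) (by rw [dist_partner hconn (by omega), hdc]) with h3 | h3
      · rwa [h3] at hrel2
      · rw [partner_partner hconn hle (by omega)] at h3
        have : f (G.partner v c) = f c := by rw [h3, h2]
        rwa [f.injective this]
    · rwa [h2] at hrel'
  · rwa [h1, partner_partner hconn hle ha] at hrel

/-- A choice of one vertex from each pair of distinct mates at distance at least two from `v`. -/
structure IsSelection (G : SimpleGraph V) (v : V) (T : Set V) : Prop where
  partner_ne : ∀ a, 2 ≤ G.dist v a → a ∈ T → G.partner v a ≠ a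
  mem_iff : ∀ a, 2 ≤ G.dist v a → G.partner v a ≠ a → (a ∈ T ↔ G.partner v a ∉ T)
  exists_related : ∀ a, 2 ≤ G.dist v a → a ∈ T → (∃ b, G.Related v a b) →
    ∃ b, G.Related v a b ∧ b ∉ T

theorem exists_isSelection (hconn : G.Connected) (hle : ∀ u, G.valence u ≤ 3) (v : V) :
    ∃ T : Set V, G.IsSelection v T := by
  have level : ∀ n, 2 ≤ n → ∃ T : Finset V,
      (∀ a, G.dist v a = n → a ∈ T → G.partner v a ≠ a) ∧
      (∀ a, G.dist v a = n → G.partner v a ≠ a → (a ∈ T ↔ G.partner v a ∉ T)) ∧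
      ∀ a, G.dist v a = n → a ∈ T → (∃ b, G.Related v a b) → ∃ b, G.Related v a b ∧ b ∉ T := by
    intro n hn
    have hS : ∀ a, a ∈ (finite_setOf_dist_eq (v := v) hconn hle n).toFinset ↔ G.dist v a = n := by
      simp
    obtain ⟨T, h1, h2, h3⟩ := exists_selection_of_finite
      (finite_setOf_dist_eq (v := v) hconn hle n).toFinset (G.partner v)
      (fun a b => G.dist v a = n ∧ G.Related v a b)
      (fun a ha => by
        rw [hS] at ha ⊢
        rw [dist_partner hconn (by omega), ha])
      (fun a ha => partner_partner hconn hle (by rw [hS] at ha; omega))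
      (fun a b h => ⟨h.2.1.trans h.1, h.2.symm hconn (by omega)⟩)
      (fun a h => h.2.2.1 (Mate.refl a))
      (fun a ha c hc _ _ h => by
        rw [hS] at ha
        exact ⟨ha, h.2.partner_right hconn hle (by omega)⟩)
    simp only [hS] at h1 h2 h3
    refine ⟨T, h1, h2, fun a ha haT ⟨b, hb⟩ => ?_⟩
    obtain ⟨c, hc, hcT⟩ := h3 a ha haT ⟨b, ha, hb⟩
    exact ⟨c, hc.2, hcT⟩
  choose! T h1 h2 h3 using level
  refine ⟨{u | u ∈ T (G.dist v u)}, fun a ha haT => h1 _ ha a rfl haT, fun a ha hne => ?_,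
    fun a ha haT hb => ?_⟩
  · simp only [Set.mem_ofPred_eq, dist_partner hconn (show 0 < G.dist v a by omega)]
    exact h2 _ ha a rfl hne
  · obtain ⟨b, hb, hbT⟩ := h3 _ ha a rfl haT hb
    refine ⟨b, hb, ?_⟩
    simp only [Set.mem_ofPred_eq, hb.1]
    exact hbT

/-! ### Twins and the colouring -/

/-- Adjacent vertices with the same neighbours apart from each other. -/
def AdjTwin (G : SimpleGraph V) (a b : V) : Prop :=
  G.Adj a b ∧ ∀ z, z ≠ a → z ≠ b → (G.Adj a z ↔ G.Adj b z)

theorem AdjTwin.map {a b : V} (h : G.AdjTwin a b) (φ : G ≃g G) : G.AdjTwin (φ a) (φ b) := by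
  refine ⟨φ.map_rel_iff.2 h.1, fun z hza hzb => ?_⟩
  obtain ⟨z, rfl⟩ := φ.surjective z
  rw [φ.map_adj_iff, φ.map_adj_iff]
  exact h.2 z (fun e => hza (e ▸ rfl)) (fun e => hzb (e ▸ rfl))

theorem exists_iso_swap {a b : V} (h : ∀ z, G.Adj a z ↔ G.Adj b z) :
    ∃ φ : G ≃g G, φ a = b ∧ ∀ z, z ≠ a → z ≠ b → φ z = z := by
  classical
  refine ⟨⟨Equiv.swap a b, fun {x y} => ?_⟩, Equiv.swap_apply_left a b,
    fun z hza hzb => Equiv.swap_apply_of_ne_of_ne hza hzb⟩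
  have hl : ∀ x z, G.Adj (Equiv.swap a b x) z ↔ G.Adj x z := by
    intro x z
    rcases eq_or_ne x a with rfl | hxa
    · rw [Equiv.swap_apply_left, h]
    rcases eq_or_ne x b with rfl | hxb
    · rw [Equiv.swap_apply_right, h]
    rw [Equiv.swap_apply_of_ne_of_ne hxa hxb]
  rw [hl, G.adj_comm, hl, G.adj_comm]

/-- The black vertices of the colouring given by the selection `T`. -/
def blackSet (G : SimpleGraph V) (v : V) (T : Set V) : Set V :=
  {u | u = v ∨ G.Adj v u ∧ ¬ G.AdjTwin v u ∨ 2 ≤ G.dist v u ∧ u ∈ T}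

theorem mem_of_mem_blackSet {T : Set V} {u : V} (hu : u ∈ G.blackSet v T)
    (hd : 2 ≤ G.dist v u) : u ∈ T := by
  rcases hu with rfl | h | h
  · simp at hd
  · rw [dist_eq_one_iff_adj.2 h.1] at hd
    omega
  · exact h.2

theorem IsTypeOne.map_eq_of_adj (htype : G.IsTypeOne v) {φ : G ≃g G} (hφ : φ v = v) {w : V}
    (hw : G.Adj v w) : φ w = w := by
  have := htype φ hφ s(v, w) ((G.mk'_mem_incidenceSet_left_iff).2 hw)
  rw [Sym2.map_mk, hφ] at this
  exact Sym2.congr_right.1 this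

/-! ### Recognising the root by its colour -/

/-- A black neighbour of `x` farther from `v` than `x` forces a white one. -/
theorem IsSelection.not_adj_of_dist_eq_succ (hconn : G.Connected)
    {T : Set V} (hT : G.IsSelection v T) {x y : V} (hx : 0 < G.dist v x)
    (hnbr : ∀ y, G.Adj x y → y ∈ G.blackSet v T ∨ G.AdjTwin x y)
    (hd : G.dist v y = G.dist v x + 1) : ¬ G.Adj x y := by
  -- A twin of `x` is adjacent to a parent of `x`, so it cannot lie farther out than `x`.
  have htwin : ∀ z, G.dist v z = G.dist v x + 1 → ¬ G.AdjTwin x z := by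
    intro z hz h
    obtain ⟨p, hpx, hp⟩ := hconn.exists_adj_dist_succ_eq (v := v) (a := x) (by omega)
    have := hconn.dist_le_succ_of_adj (v := v)
      ((h.2 p hpx.ne (by rintro rfl; omega)).1 hpx.symm).symm
    omega
  intro hxy
  have hyT := mem_of_mem_blackSet ((hnbr y hxy).resolve_right (htwin y hd)) (by omega)
  have hne := hT.partner_ne y (by omega) hyT
  have hdp := dist_partner hconn (show 0 < G.dist v y by omega)
  have hadj := (mate_partner (G := G) (v := v) y).adj hxy (by omega)
  refine (hT.mem_iff y (by omega) hne).1 hyT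
    (mem_of_mem_blackSet ((hnbr _ hadj).resolve_right (htwin _ (by omega))) (by omega))

/-- Without children, the closed neighbourhood of `x` lies in that of `v`. Both have four elements,
so they agree and `x` is an adjacent twin of `v`, hence white. -/
theorem dist_ne_one_of_black (hconn : G.Connected)
    (hv : G.valence v = 3) {T : Set V} (hT : G.IsSelection v T) {x : V}
    (hx : x ∈ G.blackSet v T) (hx3 : G.valence x = 3)
    (hnbr : ∀ y, G.Adj x y → y ∈ G.blackSet v T ∨ G.AdjTwin x y) : G.dist v x ≠ 1 := by
  intro hd
  have hvx : G.Adj v x := dist_eq_one_iff_adj.1 hd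
  have hntwin : ¬ G.AdjTwin v x := by
    rcases hx with rfl | h | h
    · exact absurd hvx (G.loopless.irrefl _)
    · exact h.2
    · omega
  have hsub : insert x (G.neighborSet x) ⊆ insert v (G.neighborSet v) := by
    rintro z (rfl | hz)
    · exact Or.inr hvx
    · have h1 := hconn.dist_le_succ_of_adj (v := v) hz
      have h2 : G.dist v z ≠ G.dist v x + 1 := fun h =>
        hT.not_adj_of_dist_eq_succ hconn (by omega) hnbr h hz
      rcases Nat.eq_zero_or_pos (G.dist v z) with h | h
      · exact Or.inl (hconn.dist_eq_zero_iff.1 h).symm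
      · exact Or.inr (dist_eq_one_iff_adj.1 (by omega))
  have hcard : ∀ u, G.valence u = 3 → (insert u (G.neighborSet u)).encard = 4 := fun u hu => by
    rw [Set.encard_insert_of_notMem (by simp), show (G.neighborSet u).encard = 3 from hu]
    norm_num
  have heq := Set.Finite.eq_of_subset_of_encard_le
    (Set.finite_of_encard_le_coe (k := 4) (hcard x hx3).le) hsub (by rw [hcard x hx3, hcard v hv])
  refine hntwin ⟨hvx, fun z hzv hzx => ?_⟩
  have := Set.ext_iff.1 heq z
  simp only [Set.mem_insert_iff, mem_neighborSet, hzv, hzx, false_or] at this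
  exact this.symm

theorem dist_lt_two_of_black (hconn : G.Connected) (hle : ∀ u, G.valence u ≤ 3)
    (htype : G.IsTypeOne v) {T : Set V} (hT : G.IsSelection v T) {x : V}
    (hx : x ∈ G.blackSet v T) (hx3 : G.valence x = 3)
    (hnbr : ∀ y, G.Adj x y → y ∈ G.blackSet v T ∨ G.AdjTwin x y) : G.dist v x < 2 := by
  by_contra! hd
  have hchild : ∀ y, G.dist v y = G.dist v x + 1 → ¬ G.Adj x y := fun y hy =>
    hT.not_adj_of_dist_eq_succ hconn (by omega) hnbr hy
  have hxT := mem_of_mem_blackSet hx hd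
  have hne := hT.partner_ne x hd hxT
  have hdp := dist_partner hconn (show 0 < G.dist v x by omega)
  -- The neighbours of a neighbour of `x` closer to `v`.
  have hdown : ∀ p q, G.Adj x p → G.dist v p + 1 = G.dist v x → G.Adj q p →
      G.dist v q + 1 = G.dist v p →
      ∀ z, G.Adj p z ↔ z = q ∨ z = x ∨ z = G.partner v x := by
    intro p q hxp hp hqp hq z
    have hadj := (mate_partner (G := G) (v := v) x).adj hxp.symm (by omega)
    constructor
    · intro hz
      exact eq_of_valence_le_three (hle p) hqp.symm hxp.symm hadj hz
        (by rintro rfl; omega) (by rintro rfl; omega) hne.symm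
    · rintro (rfl | rfl | rfl)
      · exact hqp.symm
      · exact hxp.symm
      · exact hadj
  -- A twin on the level of `x` shares a parent with `x`, whose only neighbours on this level are
  -- `x` and its partner.
  have htwin : ∀ y, G.dist v y = G.dist v x → G.AdjTwin x y → y = G.partner v x := by
    intro y hy h
    obtain ⟨p, hpx, hp⟩ := hconn.exists_adj_dist_succ_eq (v := v) (a := x) (by omega)
    obtain ⟨q, hqp, hq⟩ := hconn.exists_adj_dist_succ_eq (v := v) (a := p) (by omega)
    have hyp := (h.2 p hpx.ne (by rintro rfl; omega)).1 hpx.symm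
    rcases (hdown p q hpx.symm hp hqp hq y).1 hyp.symm with rfl | rfl | h'
    · omega
    · exact absurd h.1 (G.loopless.irrefl _)
    · exact h'
  have hblack : ∀ p, G.Adj x p → G.dist v p + 1 = G.dist v x → p ∈ G.blackSet v T := by
    intro p hxp hp
    refine (hnbr p hxp).resolve_right fun h => ?_
    obtain ⟨q, hqp, hq⟩ := hconn.exists_adj_dist_succ_eq (v := v) (a := p) (by omega)
    have := hconn.dist_le_succ_of_adj (v := v)
      ((h.2 q (by rintro rfl; omega) hqp.ne).2 hqp.symm).symm
    omega
  by_cases hhor : ∃ y, G.Adj x y ∧ G.dist v y = G.dist v x ∧ y ≠ G.partner v x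
  · obtain ⟨y, hxy, hy, hyne⟩ := hhor
    have hrel : G.Related v x y := by
      refine ⟨hy, fun h => ?_, Or.inl hxy⟩
      rcases h.eq_or_eq_partner hconn hle hd with h | h
      · exact hxy.ne h.symm
      · exact hyne h
    -- The white related vertex `b` must be adjacent to `x`, which has no children; being neither
    -- black nor a mate, hence not a twin, it contradicts `hnbr`.
    obtain ⟨b, ⟨hbd, hbm, hb⟩, hbT⟩ := hT.exists_related x hd hxT ⟨y, hrel⟩
    rcases hb with hb | ⟨c, hc, hxc, -⟩
    · rcases hnbr b hb with h | h
      · exact hbT (mem_of_mem_blackSet h (by omega))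
      · exact hbm (htwin b hbd h ▸ mate_partner x)
    · exact hchild c hc hxc
  · have hcases : ∀ y, G.Adj x y → y = G.partner v x ∨ G.dist v y + 1 = G.dist v x := by
      intro y hxy
      by_cases hyp : y = G.partner v x
      · exact Or.inl hyp
      · have h1 := hconn.dist_le_succ_of_adj (v := v) hxy
        have h2 := hconn.dist_le_succ_of_adj (v := v) hxy.symm
        have h3 : G.dist v y ≠ G.dist v x + 1 := fun h => hchild y h hxy
        have h4 : G.dist v y ≠ G.dist v x := fun h => hhor ⟨y, hxy, h, hyp⟩
        right
        omega
    -- At most one of the three neighbours is the partner; the others are parents.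
    obtain ⟨p₁, p₂, hp, h1, h2, hd1, hd2⟩ : ∃ p₁ p₂, p₁ ≠ p₂ ∧ G.Adj x p₁ ∧ G.Adj x p₂ ∧
        G.dist v p₁ + 1 = G.dist v x ∧ G.dist v p₂ + 1 = G.dist v x := by
      obtain ⟨a, b, c, hab, hac, hbc, hN⟩ := Set.encard_eq_three.1 hx3
      have ha : G.Adj x a := by rw [← mem_neighborSet, hN]; simp
      have hb : G.Adj x b := by rw [← mem_neighborSet, hN]; simp
      have hc : G.Adj x c := by rw [← mem_neighborSet, hN]; simp
      rcases hcases a ha with h | h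
      · exact ⟨b, c, hbc, hb, hc, (hcases b hb).resolve_left fun e => hab (h.trans e.symm),
          (hcases c hc).resolve_left fun e => hac (h.trans e.symm)⟩
      · rcases hcases b hb with h' | h'
        · exact ⟨a, c, hac, ha, hc, h,
            (hcases c hc).resolve_left fun e => hbc (h'.trans e.symm)⟩
        · exact ⟨a, b, hab, ha, hb, h, h'⟩
    obtain ⟨q₁, hqp1, hq1⟩ := hconn.exists_adj_dist_succ_eq (v := v) (a := p₁) (by omega)
    obtain ⟨q₂, hqp2, hq2⟩ := hconn.exists_adj_dist_succ_eq (v := v) (a := p₂) (by omega)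
    have hN1 := hdown p₁ q₁ h1 hd1 hqp1 hq1
    have hN2 := hdown p₂ q₂ h2 hd2 hqp2 hq2
    rcases hd.lt_or_eq with hd' | hd'
    · have hT1 := mem_of_mem_blackSet (hblack p₁ h1 hd1) (by omega)
      have hT2 := mem_of_mem_blackSet (hblack p₂ h2 hd2) (by omega)
      have hrel : G.Related v p₁ p₂ := by
        refine ⟨by omega, fun h => ?_, Or.inr ⟨x, hd1.symm, h1.symm, h2.symm⟩⟩
        rcases h.eq_or_eq_partner hconn hle (by omega) with h | h
        · exact hp h.symm
        · exact (hT.mem_iff p₁ (by omega) (hT.partner_ne p₁ (by omega) hT1)).1 hT1 (h ▸ hT2)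
      -- The black parents are related through `x`. The children of `p₁` are just `x` and its
      -- partner, so `b` is a neighbour of one of them, hence a parent of `x`, hence black.
      obtain ⟨b, ⟨hbd, -, hb⟩, hbT⟩ := hT.exists_related p₁ (by omega) hT1 ⟨p₂, hrel⟩
      refine hbT (mem_of_mem_blackSet (hblack b ?_ (by omega)) (by omega))
      rcases hb with hb | ⟨c, hc, hpc, hbc⟩
      · rcases (hN1 b).1 hb with rfl | rfl | rfl <;> omega
      · rcases (hN1 c).1 hpc with rfl | rfl | rfl
        · omega
        · exact hbc.symm
        · exact (((mate_partner x).symm hconn (by omega)).adj hbc (by omega)).symm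
    -- At distance 2 both parents have exactly the neighbours `v`, `x` and the partner of `x`;
    -- swapping them is an automorphism fixing `v` but not its edges.
    · have hv1 : q₁ = v := (hconn.dist_eq_zero_iff.1 (by omega : G.dist v q₁ = 0)).symm
      have hv2 : q₂ = v := (hconn.dist_eq_zero_iff.1 (by omega : G.dist v q₂ = 0)).symm
      obtain ⟨φ, hφ, hfix⟩ := exists_iso_swap (G := G) (a := p₁) (b := p₂) fun z => by
        rw [hN1, hN2, hv1, hv2]
      have hφv : φ v = v := hfix v (hv1 ▸ hqp1.ne) (hv2 ▸ hqp2.ne)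
      exact hp ((htype.map_eq_of_adj hφv (hv1 ▸ hqp1)).symm.trans hφ)

theorem map_root_eq_of_preserves (hconn : G.Connected) (hle : ∀ u, G.valence u ≤ 3)
    (hv : G.valence v = 3) (htype : G.IsTypeOne v) {T : Set V} (hT : G.IsSelection v T)
    {φ : G ≃g G} (hφ : ∀ u, φ u ∈ G.blackSet v T ↔ u ∈ G.blackSet v T) : φ v = v := by
  have hx : φ v ∈ G.blackSet v T := (hφ v).2 (Or.inl rfl)
  have hx3 : G.valence (φ v) = 3 := by
    rw [← hv, valence, valence, ← φ.injective.encard_image (G.neighborSet v)]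
    congr 1
    ext z
    obtain ⟨z, rfl⟩ := φ.surjective z
    simp [φ.map_adj_iff]
  have hnbr : ∀ y, G.Adj (φ v) y → y ∈ G.blackSet v T ∨ G.AdjTwin (φ v) y := by
    intro y hy
    obtain ⟨y, rfl⟩ := φ.surjective y
    rw [φ.map_adj_iff] at hy
    by_cases h : G.AdjTwin v y
    · exact Or.inr (h.map φ)
    · exact Or.inl ((hφ y).2 (Or.inr (Or.inl ⟨hy, h⟩)))
  have h2 := dist_lt_two_of_black hconn hle htype hT hx hx3 hnbr
  have h1 := dist_ne_one_of_black hconn hv hT hx hx3 hnbr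
  exact (hconn.dist_eq_zero_iff.1 (by omega : G.dist v (φ v) = 0)).symm

/-! ### Rigidity and the distinguishing number -/

theorem eq_of_preserves_blackSet (hconn : G.Connected) (hle : ∀ u, G.valence u ≤ 3)
    (htype : G.IsTypeOne v) {T : Set V} (hT : G.IsSelection v T) {φ : G ≃g G}
    (hφ : ∀ u, φ u ∈ G.blackSet v T ↔ u ∈ G.blackSet v T) (hφv : φ v = v) (u : V) :
    φ u = u := by
  induction hn : G.dist v u using Nat.strong_induction_on generalizing u with
  | _ n ih =>
    obtain h0 | h1 | h2 : n = 0 ∨ n = 1 ∨ 2 ≤ n := by omega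
    · rw [← hconn.dist_eq_zero_iff.1 (hn.trans h0), hφv]
    · exact htype.map_eq_of_adj hφv (dist_eq_one_iff_adj.1 (hn.trans h1))
    · have hm : G.Mate v u (φ u) := ⟨φ, fun w hw => ih _ (hn ▸ hw) w rfl, rfl⟩
      have hd := hm.dist_eq hconn (by omega)
      rcases hm.eq_or_eq_partner hconn hle (by omega) with h | h
      · exact h
      · by_contra hne
        have hiff := hT.mem_iff u (by omega) (h ▸ hne)
        rw [← h] at hiff
        have hmem : ∀ w, 2 ≤ G.dist v w → (w ∈ G.blackSet v T ↔ w ∈ T) := fun w hw =>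
          ⟨fun h => mem_of_mem_blackSet h hw, fun h => Or.inr (Or.inr ⟨hw, h⟩)⟩
        have := hφ u
        rw [hmem _ (by omega), hmem _ (by omega)] at this
        tauto

theorem exists_isDistinguishing_fin_two (hconn : G.Connected) (hle : ∀ u, G.valence u ≤ 3)
    (hv : G.valence v = 3) (htype : G.IsTypeOne v) :
    ∃ c : V → Fin 2, G.IsDistinguishing c := by
  classical
  obtain ⟨T, hT⟩ := exists_isSelection hconn hle v
  refine ⟨fun u => if u ∈ G.blackSet v T then 1 else 0, fun φ hφ => ?_⟩
  have hφ' : ∀ u, φ u ∈ G.blackSet v T ↔ u ∈ G.blackSet v T := by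
    intro u
    have := hφ u
    by_cases h1 : φ u ∈ G.blackSet v T <;> by_cases h2 : u ∈ G.blackSet v T <;>
      simp_all
  exact eq_of_preserves_blackSet hconn hle htype hT hφ'
    (map_root_eq_of_preserves hconn hle hv htype hT hφ')

theorem le_distinguishingNumber {k : ℕ}
    (h : ∀ n, (∃ c : V → Fin n, G.IsDistinguishing c) → k ≤ n) :
    (k : ℕ∞) ≤ G.distinguishingNumber :=
  le_iInf₂ fun n hn => by exact_mod_cast h n hn

theorem distinguishingNumber_le {n : ℕ} {c : V → Fin n} (h : G.IsDistinguishing c) :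
    G.distinguishingNumber ≤ n :=
  iInf₂_le n ⟨c, h⟩

end SimpleGraph

open SimpleGraph in
theorem theorem5p3 {V : Type*} (G : SimpleGraph V) (hconn : G.Connected)
    (hmax : G.maxValence = 3) (v : V) (hv : G.valence v = 3) (htype : G.IsTypeOne v) :
    (Nontrivial (G ≃g G) → G.distinguishingNumber = 2) ∧
      (¬ Nontrivial (G ≃g G) → G.distinguishingNumber = 1) := by
  have hle : ∀ u, G.valence u ≤ 3 := fun u => (le_iSup G.valence u).trans hmax.le
  refine ⟨fun hnt => le_antisymm ?_ ?_, fun hnt => le_antisymm ?_ ?_⟩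
  · obtain ⟨c, hc⟩ := exists_isDistinguishing_fin_two hconn hle hv htype
    exact distinguishingNumber_le hc
  · refine le_distinguishingNumber (k := 2) fun n ⟨c, hc⟩ => ?_
    by_contra! hn
    have : Subsingleton (Fin n) := by
      rw [Fin.subsingleton_iff_le_one]; omega
    obtain ⟨φ, ψ, hne⟩ := hnt
    -- With at most one colour every automorphism preserves the colouring.
    have key : ∀ χ : G ≃g G, ∀ u, χ u = u := fun χ => hc χ fun _ => Subsingleton.elim _ _
    exact hne (RelIso.ext fun u => (key φ u).trans (key ψ u).symm)
  · rw [not_nontrivial_iff_subsingleton] at hnt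
    have hc : G.IsDistinguishing (fun _ => 0 : V → Fin 1) := fun φ _ u => by
      rw [Subsingleton.elim φ Iso.refl]; rfl
    exact distinguishingNumber_le hc
  · refine le_distinguishingNumber (k := 1) fun n ⟨c, _⟩ => ?_
    exact Fin.pos (c v)
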